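/- Let $n\ge 2$, let $\mathbb{T}^n=\{\zeta\in\mathbb{C}^n: |\zeta_1|=\dots=|\zeta_n|=1\}$ and $\mathbb{D}^n=\{z\in\mathbb{C}^n: |z_j|<1 \text{ for all } j\}$. Let $RP(\mathbb{T}^n)$ be the set of real (signed) Borel measures $\mu$ of bounded variation on $\mathbb{T}^n$ whose Poisson integral $$P[d\mu](z)=\int_{\mathbb{T}^n}\prod_{j=1}^n\frac{1-|z_j|^2}{|\zeta_j-z_j|^2}\,d\mu(\zeta),\qquad z\in\mathbb{D}^n,$$ is the real part of an analytic function on $\mathbb{D}^n$. A set $F\subset\mathbb{T}^n$ has linear measure zero if for every $\varepsilon>0$ there is a countable open cover $\{V_j\}$ of $F$ such that the sum of the diameters of the sets $V_j$ is smaller than $\varepsilon$. If $K\subset\mathbb{T}^n$ is a compact set of linear measure zero, then $K$ is a null set for $RP(\mathbb{T}^n)$, that is, $|\mu|(K)=0$ for every $\mu\in RP(\mathbb{T}^n)$. In particular, the support of a non-zero $\mu\in RP(\mathbb{T}^n)$ does not have linear measure zero, and it has Hausdorff dimension at least one. -/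

import Mathlib

open MeasureTheory
open scoped ENNReal

/-- The circle carries its Borel σ-algebra. -/
noncomputable instance instMeasurableSpaceCircle : MeasurableSpace Circle := borel Circle

instance instBorelSpaceCircle : BorelSpace Circle := ⟨rfl⟩

/-- The `n`-torus `𝕋ⁿ`, the distinguished boundary of the unit polydisc of `ℂⁿ`. It is a compact
metric space, with the distance `max_j |ζ_j - ξ_j|` (which is equivalent to the Euclidean one), and
carries its Borel σ-algebra. -/
abbrev Torus (n : ℕ) : Type := Fin n → Circle

/-- The open unit polydisc `𝔻ⁿ` in `ℂⁿ`. -/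
def polydisc (n : ℕ) : Set (Fin n → ℂ) := {z | ∀ j, ‖z j‖ < 1}

/-- The Poisson kernel of the polydisc, `∏_j (1 - |z_j|²) / |ζ_j - z_j|²`. -/
noncomputable def polyPoissonKernel {n : ℕ} (z : Fin n → ℂ) (ζ : Torus n) : ℝ :=
  ∏ j, (1 - ‖z j‖ ^ 2) / ‖(ζ j : ℂ) - z j‖ ^ 2

/-- The Poisson integral `P[dμ](z) = ∫ ∏_j (1 - |z_j|²) / |ζ_j - z_j|² dμ(ζ)` of a (finite, real)
signed Borel measure on the torus; the integral is Mathlib's integral of a real function against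
a signed measure. -/
noncomputable def poissonIntegral {n : ℕ} (μ : SignedMeasure (Torus n)) (z : Fin n → ℂ) : ℝ :=
  ∫ᵛ ζ, polyPoissonKernel z ζ ∂<•μ

/-- `RP(𝕋ⁿ)`: the real Borel measures of bounded variation on the torus whose Poisson integral is
the real part of an analytic function on the polydisc. (A signed measure with values in `ℝ` always
has finite total variation.) -/
def RP (n : ℕ) : Set (SignedMeasure (Torus n)) :=
  {μ | ∃ f : (Fin n → ℂ) → ℂ, AnalyticOnNhd ℂ f (polydisc n) ∧
    ∀ z ∈ polydisc n, poissonIntegral μ z = (f z).re}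

/-- A set `K` is a null set for a family of real measures if `|μ|(K) = 0` for every
member `μ`. -/
def IsNullSetFor {X : Type*} [MeasurableSpace X] (K : Set X) (M : Set (SignedMeasure X)) : Prop :=
  ∀ μ ∈ M, μ.variation K = 0

/-- A set `F` has linear measure zero if, for every `ε > 0`, it has a countable open cover whose
diameters have sum smaller than `ε`. -/
def HasLinearMeasureZero {X : Type*} [PseudoEMetricSpace X] (F : Set X) : Prop :=
  ∀ ε : ℝ≥0∞, 0 < ε → ∃ V : ℕ → Set X,
    (∀ j, IsOpen (V j)) ∧ F ⊆ ⋃ j, V j ∧ ∑' j, Metric.ediam (V j) < ε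

/-- The closed support of a signed measure `μ`: the points all of whose neighbourhoods have
positive `|μ|`-measure. -/
noncomputable def signedSupport {X : Type*} [TopologicalSpace X] [MeasurableSpace X]
    (μ : SignedMeasure X) : Set X :=
  μ.variation.support

/-! Write `μ = s ν` with `ν = |μ|` and `|s| = 1`. Since `P[dμ] = (f + conj f) / 2` with `f`
analytic, the Fourier coefficients of `μ` vanish at every frequency that has both a positive and a
negative entry (`integral_sign_mul_torusChar_eq_zero`). Twisting by one such character, `w = s ζ_i /
ζ_j` makes `w dν` annihilate the closed algebra generated by `ζ_l` for `l ≠ j` and `ζ_j⁻¹`, a copy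
of the polydisc algebra.

Such an annihilating measure cannot charge a compact `K` of linear measure zero. Cover `K` by balls
`B(p, r)` with small total radius and add the kernels `r / (r + ∑ (1 - conj p_l ζ_l))`, with `ζ_j`
and `p_j` conjugated. The sum `H` lies in the algebra, has nonnegative real part, is bounded below
in real part on `K`, and is `O(∑ r)` away from `K`. With `∑ r` shrinking fast enough, `exp (-m H_m)`
tends boundedly to the indicator of `Kᶜ`, so `∫_K w dν = 0`. The same holds for closed subsets of
`K`; hence `w = 0` a.e. on `K`, and `|w| = 1` forces `ν(K) = 0`. -/

/-- A signed measure is its variation times a measurable sign. -/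
theorem exists_sign_integral_eq {X : Type*} [MeasurableSpace X] (μ : SignedMeasure X) :
    ∃ s : X → ℝ, Measurable s ∧ (∀ x, |s x| = 1) ∧
      ∀ g : X → ℝ, Integrable g μ.variation →
        ∫ᵛ x, g x ∂<•μ = ∫ x, s x * g x ∂μ.variation := by
  classical
  -- `i` is a Hahn set: the positive part lives on `i`, the negative part off it.
  obtain ⟨i, hi, hpos, hneg, hp, hq⟩ := μ.toJordanDecomposition_spec
  set p := μ.toJordanDecomposition.posPart
  set q := μ.toJordanDecomposition.negPart
  have hpi : p iᶜ = 0 := by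
    rw [hp, SignedMeasure.toMeasureOfZeroLE_apply _ _ _ hi.compl]; simp
  have hqi : q i = 0 := by
    rw [hq, SignedMeasure.toMeasureOfLEZero_apply _ _ _ hi]; simp
  have hν : μ.variation = p + q := μ.totalVariation_eq_variation.symm
  have hμ : μ = p.toSignedMeasure - q.toSignedMeasure :=
    μ.toSignedMeasure_toJordanDecomposition.symm
  refine ⟨fun x ↦ if x ∈ i then 1 else -1,
    Measurable.ite hi measurable_const measurable_const, fun x ↦ ?_, fun g hg ↦ ?_⟩
  · dsimp only; split_ifs <;> simp
  · rw [hν] at hg ⊢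
    have hgp : Integrable g p := hg.left_of_add_measure
    have hgq : Integrable g q := hg.right_of_add_measure
    have ep : (fun x ↦ (if x ∈ i then (1 : ℝ) else -1) * g x) =ᵐ[p] g := by
      have : ∀ᵐ x ∂p, x ∈ i := by rw [ae_iff]; exact hpi
      filter_upwards [this] with x hx
      simp [hx]
    have eq : (fun x ↦ (if x ∈ i then (1 : ℝ) else -1) * g x) =ᵐ[q] fun x ↦ -g x := by
      have : ∀ᵐ x ∂q, x ∉ i := by rw [ae_iff]; simpa using hqi
      filter_upwards [this] with x hx
      simp [hx]
    rw [integral_add_measure (hgp.congr ep.symm) (hgq.neg.congr eq.symm),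
      integral_congr_ae ep, integral_congr_ae eq, integral_neg]
    conv_lhs => rw [hμ]
    rw [VectorMeasure.integral_sub_vectorMeasure, VectorMeasure.integral_toSignedMeasure,
      VectorMeasure.integral_toSignedMeasure, sub_eq_add_neg]
    · simpa [VectorMeasure.Integrable] using hgp
    · simpa [VectorMeasure.Integrable] using hgq

/-! ### Linear measure zero: Hausdorff dimension and finite covers -/

theorem HasLinearMeasureZero.mono {X : Type*} [PseudoEMetricSpace X] {F G : Set X}
    (hG : HasLinearMeasureZero G) (h : F ⊆ G) : HasLinearMeasureZero F := fun ε hε ↦ by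
  obtain ⟨V, h1, h2, h3⟩ := hG ε hε
  exact ⟨V, h1, h.trans h2, h3⟩

theorem hasLinearMeasureZero_of_dimH_lt_one {X : Type*} [MetricSpace X] {F : Set X}
    (h : dimH F < 1) : HasLinearMeasureZero F := by
  borelize X
  intro ε hε
  have h0 : Measure.hausdorffMeasure (1 : ℝ) F = 0 := by
    have := hausdorffMeasure_of_dimH_lt (s := F) (d := 1) (by simpa using h)
    simpa using this
  rw [Measure.hausdorffMeasure_apply] at h0
  simp only [ENNReal.iSup_eq_zero] at h0
  -- Only the sum of the diameters matters, so a single scale suffices.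
  have h1 := h0 1 one_pos
  have hε2 : ε / 2 ≠ 0 := by simpa using hε.ne'
  have h2 : _ < ε / 2 := h1.trans_lt (pos_iff_ne_zero.2 hε2)
  simp only [iInf_lt_iff] at h2
  obtain ⟨t, ht, -, hsum⟩ := h2
  obtain ⟨δ, hδ, hδs⟩ := ENNReal.exists_pos_sum_of_countable hε2 ℕ
  have hd : ∀ n, (⨆ _ : (t n).Nonempty, Metric.ediam (t n) ^ (1 : ℝ)) = Metric.ediam (t n) := by
    intro n
    rcases (t n).eq_empty_or_nonempty with h | h
    · simp [h]
    · simp [h]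
  simp only [hd] at hsum
  -- Thickening by `δ n / 2` makes the pieces open and adds at most `δ n` to each diameter.
  refine ⟨fun n ↦ Metric.thickening ((δ n / 2 : NNReal) : ℝ) (t n), fun n ↦ Metric.isOpen_thickening,
    ht.trans (Set.iUnion_mono fun n ↦ Metric.self_subset_thickening (by have := hδ n; positivity) _), ?_⟩
  calc ∑' n, Metric.ediam (Metric.thickening ((δ n / 2 : NNReal) : ℝ) (t n))
      ≤ ∑' n, (Metric.ediam (t n) + δ n) := by
        refine ENNReal.tsum_le_tsum fun n ↦ (Metric.ediam_thickening_le _).trans_eq ?_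
        congr 1
        rw [ENNReal.coe_div two_ne_zero]
        exact ENNReal.mul_div_cancel two_ne_zero (by simp)
    _ = ∑' n, Metric.ediam (t n) + ∑' n, (δ n : ℝ≥0∞) := ENNReal.tsum_add
    _ < ε / 2 + ε / 2 := ENNReal.add_lt_add hsum hδs
    _ = ε := ENNReal.add_halves ε

/-- A compact set of linear measure zero is covered by finitely many balls centred on it whose
radii have a small sum. -/
theorem HasLinearMeasureZero.exists_finite_cover {X : Type*} [PseudoMetricSpace X] {K : Set X}
    (hK : IsCompact K) (h0 : HasLinearMeasureZero K) {ε : ℝ} (hε : 0 < ε) :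
    ∃ (t : Finset ℕ) (p : t → X) (r : t → ℝ), (∀ q, p q ∈ K) ∧ (∀ q, 0 < r q) ∧
      (∀ x ∈ K, ∃ q, dist x (p q) ≤ r q) ∧ ∑ q, r q ≤ ε := by
  classical
  have hε2 : ENNReal.ofReal (ε / 2) ≠ 0 := by simpa using hε
  obtain ⟨V, hVo, hKV, hV⟩ := h0 _ (pos_iff_ne_zero.2 hε2)
  obtain ⟨δ, hδ, hδs⟩ := ENNReal.exists_pos_sum_of_countable hε2 ℕ
  obtain ⟨t, ht⟩ := hK.elim_finite_subcover V hVo hKV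
  -- Sets missing `K` are dropped so that every centre can be taken in `K`.
  let t' := t.filter fun n ↦ (V n ∩ K).Nonempty
  have hne : ∀ q : t', (V q ∩ K).Nonempty := fun q ↦ (Finset.mem_filter.1 q.2).2
  choose p hp using hne
  have hfin : ∀ n, Metric.ediam (V n) ≠ ∞ := fun n ↦
    ((ENNReal.le_tsum n).trans_lt (hV.trans ENNReal.ofReal_lt_top)).ne
  -- The summand `δ q` keeps the radius positive when the diameter is zero.
  refine ⟨t', p, fun q ↦ Metric.diam (V q) + δ q, fun q ↦ (hp q).2, fun q ↦ ?_, fun x hx ↦ ?_, ?_⟩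
  · have := hδ q
    have := Metric.diam_nonneg (s := V q)
    positivity
  · obtain ⟨n, hn, hxn⟩ := Set.mem_iUnion₂.1 (ht hx)
    refine ⟨⟨n, Finset.mem_filter.2 ⟨hn, x, hxn, hx⟩⟩, ?_⟩
    refine (Metric.dist_le_diam_of_mem' (hfin n) hxn (hp ⟨n, _⟩).1).trans ?_
    simp
  · rw [Finset.sum_coe_sort t' (fun n ↦ Metric.diam (V n) + (δ n : ℝ)), ← ENNReal.ofReal_le_ofReal_iff hε.le,
      ENNReal.ofReal_sum_of_nonneg (fun n _ ↦ add_nonneg Metric.diam_nonneg (δ n).coe_nonneg)]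
    calc ∑ n ∈ t', ENNReal.ofReal (Metric.diam (V n) + δ n)
        = ∑ n ∈ t', (Metric.ediam (V n) + δ n) := by
          refine Finset.sum_congr rfl fun n _ ↦ ?_
          rw [ENNReal.ofReal_add Metric.diam_nonneg (δ n).coe_nonneg, Metric.diam,
            ENNReal.ofReal_toReal (hfin n), ENNReal.ofReal_coe_nnreal]
      _ ≤ ∑' n, (Metric.ediam (V n) + δ n) := ENNReal.sum_le_tsum _
      _ = ∑' n, Metric.ediam (V n) + ∑' n, (δ n : ℝ≥0∞) := ENNReal.tsum_add
      _ ≤ ENNReal.ofReal (ε / 2) + ENNReal.ofReal (ε / 2) := add_le_add hV.le hδs.le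
      _ = ENNReal.ofReal ε := by rw [← ENNReal.ofReal_add (by positivity) (by positivity), add_halves]

theorem variation_compl_signedSupport {X : Type*} [TopologicalSpace X] [HereditarilyLindelofSpace X]
    [MeasurableSpace X] (μ : SignedMeasure X) : μ.variation (signedSupport μ)ᶜ = 0 :=
  Measure.measure_compl_support

/-! ### Poisson kernels and Fourier coefficients on the torus -/

/-- Arc length on the circle. -/
noncomputable def arcMeasure : Measure Circle :=
  (volume.restrict (Set.Ioc 0 (2 * Real.pi))).map Circle.exp

instance : IsFiniteMeasure arcMeasure := by
  unfold arcMeasure; infer_instance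

theorem integral_arcMeasure {g : Circle → ℂ} (hg : Continuous g) :
    ∫ ξ, g ξ ∂arcMeasure = ∫ t in (0 : ℝ)..2 * Real.pi, g (Circle.exp t) := by
  rw [arcMeasure, integral_map Circle.exp.continuous.aemeasurable hg.aestronglyMeasurable,
    intervalIntegral.integral_of_le (by positivity)]

theorem integral_arcMeasure_eq_circleAverage {g : ℂ → ℂ} (hg : Continuous fun ξ : Circle ↦ g ξ) :
    ∫ ξ : Circle, g ξ ∂arcMeasure = 2 * Real.pi * Real.circleAverage g 0 1 := by
  rw [integral_arcMeasure hg, Real.circleAverage_def]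
  have : ((2 * Real.pi : ℝ) : ℂ) ≠ 0 := by exact_mod_cast Real.two_pi_pos.ne'
  simp only [Circle.coe_exp, circleMap_zero, Complex.ofReal_one, one_mul, Complex.real_smul,
    Complex.ofReal_inv]
  rw [← mul_assoc, ← Complex.ofReal_ofNat, ← Complex.ofReal_mul, mul_inv_cancel₀ this, one_mul]

/-- This symmetry lets the kernel be integrated over the direction `ξ` of the interior point, as a
Poisson integral evaluated at `rζ`. -/
theorem norm_sub_mul_circle_comm (r : ℝ) (ζ ξ : Circle) :
    ‖(ζ : ℂ) - r * ξ‖ = ‖(ξ : ℂ) - r * ζ‖ := by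
  have h : ‖(ζ : ℂ) - r * ξ‖ ^ 2 = ‖(ξ : ℂ) - r * ζ‖ ^ 2 := by
    have h1 := Circle.normSq_coe ζ
    have h2 := Circle.normSq_coe ξ
    simp only [Complex.sq_norm, Complex.normSq_apply, Complex.sub_re, Complex.sub_im,
      Complex.mul_re, Complex.mul_im, Complex.ofReal_re, Complex.ofReal_im] at *
    linear_combination (1 - r ^ 2) * h1 - (1 - r ^ 2) * h2
  exact (sq_eq_sq₀ (norm_nonneg _) (norm_nonneg _)).1 h

theorem circle_sub_mul_ne_zero {r : ℝ} (h0 : 0 ≤ r) (h1 : r < 1) (ζ ξ : Circle) :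
    ‖(ζ : ℂ) - r * ξ‖ ≠ 0 := by
  intro h
  rw [norm_eq_zero, sub_eq_zero] at h
  have := congrArg norm h
  simp only [norm_mul, Circle.norm_coe, Complex.norm_real, Real.norm_eq_abs, abs_of_nonneg h0,
    mul_one] at this
  linarith

theorem continuous_circle_poisson {r : ℝ} (h0 : 0 ≤ r) (h1 : r < 1) :
    Continuous fun x : Circle × Circle ↦ (1 - ‖(r : ℂ) * x.1‖ ^ 2) / ‖(x.2 : ℂ) - r * x.1‖ ^ 2 := by
  refine Continuous.div (by fun_prop) (by fun_prop) fun x ↦ ?_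
  exact pow_ne_zero _ (circle_sub_mul_ne_zero h0 h1 _ _)

/-- After swapping `ζ` and `ξ`, the Poisson formula reproduces the analytic function `z ^ m` at
`rζ`; the factor `2π` comes from unnormalised arc length. -/
theorem integral_poisson_mul_pow {r : ℝ} (h0 : 0 ≤ r) (h1 : r < 1) (ζ : Circle) (m : ℕ) :
    ∫ ξ : Circle, (((1 - ‖(r : ℂ) * ξ‖ ^ 2) / ‖(ζ : ℂ) - r * ξ‖ ^ 2 : ℝ) : ℂ) * (ξ : ℂ) ^ m ∂arcMeasure
      = 2 * Real.pi * (r : ℂ) ^ m * (ζ : ℂ) ^ m := by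
  have hw : (r : ℂ) * ζ ∈ Metric.ball (0 : ℂ) 1 := by
    simpa [abs_of_nonneg h0, Circle.norm_coe] using h1
  have hf : DiffContOnCl ℂ (fun z : ℂ ↦ z ^ m) (Metric.ball 0 1) :=
    (differentiable_pow m).diffContOnCl
  have key := hf.circleAverage_poissonKernel_smul' hw
  let g : ℂ → ℂ := fun z ↦
    ((‖z - 0‖ ^ 2 - ‖(r : ℂ) * ζ - 0‖ ^ 2) / ‖(z - 0) - ((r : ℂ) * ζ - 0)‖ ^ 2) • z ^ m
  have e : (fun ξ : Circle ↦ (((1 - ‖(r : ℂ) * ξ‖ ^ 2) / ‖(ζ : ℂ) - r * ξ‖ ^ 2 : ℝ) : ℂ) *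
      (ξ : ℂ) ^ m) = fun ξ : Circle ↦ g ξ := by
    ext ξ
    simp [g, norm_sub_mul_circle_comm r ζ ξ, Circle.norm_coe]
  have hc : Continuous fun ξ : Circle ↦ g ξ := by
    rw [← e]
    have h2 : Continuous fun ξ : Circle ↦ (1 - ‖(r : ℂ) * ξ‖ ^ 2) / ‖(ζ : ℂ) - r * ξ‖ ^ 2 :=
      Continuous.div (by fun_prop) (by fun_prop) fun ξ ↦
        pow_ne_zero _ (circle_sub_mul_ne_zero h0 h1 _ _)
    exact (Complex.continuous_ofReal.comp h2).mul (by fun_prop)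
  rw [e, integral_arcMeasure_eq_circleAverage hc, key]
  ring

theorem Circle.coe_zpow_neg_eq_conj (ξ : Circle) (m : ℕ) :
    (ξ : ℂ) ^ (-(m : ℤ)) = (starRingEnd ℂ) ((ξ : ℂ) ^ m) := by
  rw [zpow_neg, zpow_natCast, map_pow, ← Circle.coe_inv_eq_conj, Circle.coe_inv, inv_pow]

theorem integral_poisson_mul_zpow {r : ℝ} (h0 : 0 ≤ r) (h1 : r < 1) (ζ : Circle) (k : ℤ) :
    ∫ ξ : Circle, (((1 - ‖(r : ℂ) * ξ‖ ^ 2) / ‖(ζ : ℂ) - r * ξ‖ ^ 2 : ℝ) : ℂ) * (ξ : ℂ) ^ k ∂arcMeasure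
      = 2 * Real.pi * (r : ℂ) ^ k.natAbs * (ζ : ℂ) ^ k := by
  obtain ⟨m, rfl | rfl⟩ := k.eq_nat_or_neg
  · simpa using integral_poisson_mul_pow h0 h1 ζ m
  · have := congrArg (starRingEnd ℂ) (integral_poisson_mul_pow h0 h1 ζ m)
    rw [← integral_conj] at this
    simp only [Circle.coe_zpow_neg_eq_conj]
    simpa [Complex.conj_ofNat] using this

theorem continuous_polyPoissonKernel {n : ℕ} {r : ℝ} (h0 : 0 ≤ r) (h1 : r < 1) :
    Continuous fun x : Torus n × Torus n ↦ polyPoissonKernel (fun l ↦ (r : ℂ) * x.1 l) x.2 := by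
  unfold polyPoissonKernel
  refine continuous_finsetProd _ fun l _ ↦ ?_
  exact (continuous_circle_poisson h0 h1).comp
    (f := fun x : Torus n × Torus n ↦ (x.1 l, x.2 l)) (by fun_prop)

/-- The character `ζ ↦ ζᵏ` of the torus. -/
noncomputable def torusChar {n : ℕ} (k : Fin n → ℤ) (ζ : Torus n) : ℂ := ∏ l, (ζ l : ℂ) ^ k l

theorem continuous_torusChar {n : ℕ} (k : Fin n → ℤ) : Continuous (torusChar k) := by
  unfold torusChar
  refine continuous_finsetProd _ fun l _ ↦ ?_
  exact Continuous.zpow₀ (by fun_prop) _ fun x ↦ Or.inl (Circle.coe_ne_zero _)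

theorem integral_polyPoissonKernel_mul_torusChar {n : ℕ} {r : ℝ} (h0 : 0 ≤ r) (h1 : r < 1)
    (ζ : Torus n) (k : Fin n → ℤ) :
    ∫ ξ : Torus n, (polyPoissonKernel (fun l ↦ (r : ℂ) * ξ l) ζ : ℂ) * torusChar k ξ
        ∂(Measure.pi fun _ ↦ arcMeasure) =
      (∏ l, (2 * Real.pi * (r : ℂ) ^ (k l).natAbs)) * torusChar k ζ := by
  simp only [polyPoissonKernel, torusChar, Complex.ofReal_prod, ← Finset.prod_mul_distrib]
  rw [integral_fintype_prod_eq_prod (𝕜 := ℂ) (fun l (ξ : Circle) ↦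
    (((1 - ‖(r : ℂ) * ξ‖ ^ 2) / ‖(ζ l : ℂ) - r * ξ‖ ^ 2 : ℝ) : ℂ) * (ξ : ℂ) ^ k l)]
  exact Finset.prod_congr rfl fun l _ ↦ integral_poisson_mul_zpow h0 h1 _ _

/-- If all integrals over one coordinate vanish, then so does the integral over the product. -/
theorem integral_pi_eq_zero_of_update {n : ℕ} {X : Type} [MeasurableSpace X] (σ : Measure X)
    [SigmaFinite σ] (i : Fin n) {F : (Fin n → X) → ℂ}
    (h : ∀ x, ∫ t, F (Function.update x i t) ∂σ = 0) :
    ∫ x, F x ∂(Measure.pi fun _ ↦ σ) = 0 := by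
  obtain _ | n := n
  · exact i.elim0
  by_cases hF : Integrable F (Measure.pi fun _ ↦ σ)
  swap
  · exact integral_undef hF
  have mp := (measurePreserving_piFinSuccAbove (fun _ : Fin (n + 1) ↦ σ) i).symm
  rw [← mp.integral_comp']
  have hF' : Integrable (fun a ↦ F ((MeasurableEquiv.piFinSuccAbove (fun _ ↦ X) i).symm a))
      (σ.prod (Measure.pi fun _ ↦ σ)) :=
    (mp.integrable_comp_emb (MeasurableEquiv.measurableEmbedding _)).2 hF
  rw [integral_prod_symm _ hF']
  refine integral_eq_zero_of_ae (Filter.Eventually.of_forall fun y ↦ ?_)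
  by_cases hX : Nonempty X
  · obtain ⟨x0⟩ := hX
    rw [Pi.zero_apply, ← h (i.insertNth x0 y)]
    simp [MeasurableEquiv.piFinSuccAbove_symm_apply, Fin.insertNthEquiv]
  · simp only [not_nonempty_iff] at hX
    simp [Measure.eq_zero_of_isEmpty σ]

theorem mul_torus_mem_polydisc {n : ℕ} {r : ℝ} (h0 : 0 ≤ r) (h1 : r < 1) (ξ : Torus n) :
    (fun l ↦ (r : ℂ) * ξ l) ∈ polydisc n := fun l ↦ by
  simpa [abs_of_nonneg h0, Circle.norm_coe] using h1

theorem continuous_comp_mul_torus {n : ℕ} {f : (Fin n → ℂ) → ℂ}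
    (hf : AnalyticOnNhd ℂ f (polydisc n)) {r : ℝ} (h0 : 0 ≤ r) (h1 : r < 1) :
    Continuous fun ξ : Torus n ↦ f fun l ↦ (r : ℂ) * ξ l :=
  hf.continuousOn.comp_continuous (by fun_prop) fun ξ ↦ mul_torus_mem_polydisc h0 h1 ξ

/-- An analytic function on the polydisc has no Fourier coefficients of negative order in any
variable. -/
theorem integral_analytic_mul_torusChar {n : ℕ} {f : (Fin n → ℂ) → ℂ}
    (hf : AnalyticOnNhd ℂ f (polydisc n)) {r : ℝ} (h0 : 0 ≤ r) (h1 : r < 1) (k : Fin n → ℤ)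
    {i : Fin n} (hi : 0 < k i) :
    ∫ ξ : Torus n, f (fun l ↦ (r : ℂ) * ξ l) * torusChar k ξ
      ∂(Measure.pi fun _ ↦ arcMeasure) = 0 := by
  refine integral_pi_eq_zero_of_update _ i fun x ↦ ?_
  obtain ⟨m, hm⟩ := Int.eq_ofNat_of_zero_le hi.le
  have hm0 : m ≠ 0 := by rintro rfl; simp [hm] at hi
  set c : ℂ := ∏ l ∈ Finset.univ.erase i, (x l : ℂ) ^ k l with hc
  have hχ : ∀ t : Circle, torusChar k (Function.update x i t) = (t : ℂ) ^ m * c := by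
    intro t
    rw [torusChar, ← Finset.mul_prod_erase _ _ (Finset.mem_univ i), Function.update_self, hm]
    congr 1
    exact Finset.prod_congr rfl fun l hl ↦ by rw [Function.update_of_ne (Finset.ne_of_mem_erase hl)]
  let g : ℂ → ℂ := fun z ↦ f (Function.update (fun l ↦ (r : ℂ) * x l) i (r * z)) * (z ^ m * c)
  have hg : ∀ t : Circle, f (fun l ↦ (r : ℂ) * (Function.update x i t l : Circle)) *
      torusChar k (Function.update x i t) = g t := by
    intro t
    rw [hχ]
    congr 2
    ext l
    rcases eq_or_ne l i with rfl | h <;> simp [*]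
  simp_rw [hg]
  have hmem : ∀ z : ℂ, ‖z‖ ≤ 1 →
      Function.update (fun l ↦ (r : ℂ) * x l) i (r * z) ∈ polydisc n := by
    intro z hz l
    rcases eq_or_ne l i with rfl | h
    · simp only [Function.update_self, norm_mul, Complex.norm_real, Real.norm_eq_abs,
        abs_of_nonneg h0]
      nlinarith [norm_nonneg z]
    · simpa [h, abs_of_nonneg h0, Circle.norm_coe] using h1
  have hd : ∀ z : ℂ, ‖z‖ ≤ 1 → DifferentiableAt ℂ g z := by
    intro z hz
    refine DifferentiableAt.mul ?_ (by fun_prop)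
    refine DifferentiableAt.comp z (g := f) (hf _ (hmem z hz)).differentiableAt ?_
    rw [differentiableAt_pi]
    intro l
    rcases eq_or_ne l i with rfl | h
    · simp only [Function.update_self]; fun_prop
    · simp [h]
  rw [integral_arcMeasure_eq_circleAverage]
  · have key : DiffContOnCl ℂ g (Metric.ball 0 1) := by
      refine DifferentiableOn.diffContOnCl fun z hz ↦ (hd z ?_).differentiableWithinAt
      rw [closure_ball _ one_ne_zero] at hz
      simpa using hz
    -- At `w = 0` the kernel is `1` on the circle: this is the mean value property, and `g 0 = 0`
    -- because `m ≠ 0`.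
    have := key.circleAverage_poissonKernel_smul' (w := 0) (by simp)
    rw [Real.circleAverage_congr_sphere (f₂ := g)] at this
    · rw [this]; simp [g, hm0]
    · intro z hz
      have : ‖z‖ = 1 := by simpa using hz
      simp [this]
  · exact continuous_iff_continuousAt.2 fun t ↦
      ((hd t (Circle.norm_coe t).le).continuousAt.comp (x := t) (f := fun t : Circle ↦ (t : ℂ)) (by fun_prop))

theorem conj_torusChar {n : ℕ} (k : Fin n → ℤ) (ζ : Torus n) :
    (starRingEnd ℂ) (torusChar k ζ) = torusChar (-k) ζ := by
  simp only [torusChar, map_prod, map_zpow₀, ← Circle.coe_inv_eq_conj, Circle.coe_inv, inv_zpow,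
    Pi.neg_apply, zpow_neg]

/-- The Fourier coefficients of a measure in `RP` vanish at frequencies of mixed sign. -/
theorem integral_sign_mul_torusChar_eq_zero {n : ℕ} {ν : Measure (Torus n)} [IsFiniteMeasure ν]
    {s : Torus n → ℝ} (hs : Measurable s) (hs1 : ∀ x, |s x| = 1)
    {f : (Fin n → ℂ) → ℂ} (hf : AnalyticOnNhd ℂ f (polydisc n))
    (hu : ∀ z ∈ polydisc n, ∫ ζ, s ζ * polyPoissonKernel z ζ ∂ν = (f z).re)
    (k : Fin n → ℤ) {i j : Fin n} (hi : 0 < k i) (hj : k j < 0) :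
    ∫ ζ, (s ζ : ℂ) * torusChar k ζ ∂ν = 0 := by
  -- One radius is enough: the factors `r ^ |k l|` are nonzero and cancel at the end.
  obtain ⟨r, hr0, hr1⟩ := exists_between (zero_lt_one' ℝ)
  let τ : Measure (Torus n) := Measure.pi fun _ ↦ arcMeasure
  have hcf := continuous_comp_mul_torus hf hr0.le hr1
  have hck := continuous_torusChar k
  have hcP := continuous_polyPoissonKernel (n := n) hr0.le hr1
  have hint : ∀ {g : Torus n → ℂ}, Continuous g → Integrable g τ := fun hg ↦
    hg.integrable_of_hasCompactSupport (HasCompactSupport.of_compactSpace _)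
  have h0 : ∫ ξ, ((f fun l ↦ (r : ℂ) * ξ l).re : ℂ) * torusChar k ξ ∂τ = 0 := by
    -- The positive entry of `k` kills the `f` term; the negative entry, positive in `-k`, kills the
    -- conjugate term.
    have e : ∀ ξ : Torus n, ((f fun l ↦ (r : ℂ) * ξ l).re : ℂ) * torusChar k ξ =
        (1 / 2 : ℂ) * (f (fun l ↦ (r : ℂ) * ξ l) * torusChar k ξ +
          (starRingEnd ℂ) (f (fun l ↦ (r : ℂ) * ξ l) * torusChar (-k) ξ)) := by
      intro ξ
      rw [map_mul, conj_torusChar, neg_neg, Complex.re_eq_add_conj]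
      ring
    simp_rw [e]
    have hck' := continuous_torusChar (-k)
    have i1 : Integrable (fun ξ ↦ f (fun l ↦ (r : ℂ) * ξ l) * torusChar k ξ) τ :=
      hint (hcf.mul hck)
    have i2 : Integrable (fun ξ ↦
        (starRingEnd ℂ) (f (fun l ↦ (r : ℂ) * ξ l) * torusChar (-k) ξ)) τ :=
      hint (Complex.continuous_conj.comp (hcf.mul hck'))
    rw [integral_const_mul, integral_add i1 i2, integral_conj,
      integral_analytic_mul_torusChar hf hr0.le hr1 k hi,
      integral_analytic_mul_torusChar hf hr0.le hr1 (-k) (i := j) (by simpa using hj)]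
    simp
  have h1 : ∫ ξ, ((f fun l ↦ (r : ℂ) * ξ l).re : ℂ) * torusChar k ξ ∂τ =
      (∏ l, (2 * Real.pi * (r : ℂ) ^ (k l).natAbs)) * ∫ ζ, (s ζ : ℂ) * torusChar k ζ ∂ν := by
    calc _ = ∫ ξ, ∫ ζ, (s ζ : ℂ) * ((polyPoissonKernel (fun l ↦ (r : ℂ) * ξ l) ζ : ℂ) *
              torusChar k ξ) ∂ν ∂τ := by
          refine integral_congr_ae (Filter.Eventually.of_forall fun ξ ↦ ?_)
          dsimp only
          rw [← hu _ (mul_torus_mem_polydisc hr0.le hr1 ξ), ← integral_complex_ofReal,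
            ← integral_mul_const]
          simp only [Complex.ofReal_mul, mul_assoc]
      _ = ∫ ζ, ∫ ξ, (s ζ : ℂ) * ((polyPoissonKernel (fun l ↦ (r : ℂ) * ξ l) ζ : ℂ) *
              torusChar k ξ) ∂τ ∂ν := by
          refine integral_integral_swap ?_
          have hc : Continuous fun x : Torus n × Torus n ↦
              (polyPoissonKernel (fun l ↦ (r : ℂ) * x.1 l) x.2 : ℂ) * torusChar k x.1 := by
            fun_prop
          have hi : Integrable (fun x : Torus n × Torus n ↦
              (polyPoissonKernel (fun l ↦ (r : ℂ) * x.1 l) x.2 : ℂ) * torusChar k x.1)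
              (τ.prod ν) :=
            hc.integrable_of_hasCompactSupport (HasCompactSupport.of_compactSpace _)
          refine hi.bdd_mul (c := 1) (f := fun x : Torus n × Torus n ↦ (s x.2 : ℂ)) ?_ ?_
          · exact (Complex.measurable_ofReal.comp (hs.comp measurable_snd)).aestronglyMeasurable
          · exact Filter.Eventually.of_forall fun x ↦ by simp [hs1]
      _ = _ := by
          rw [← integral_const_mul]
          refine integral_congr_ae (Filter.Eventually.of_forall fun ζ ↦ ?_)
          dsimp only
          rw [integral_const_mul, integral_polyPoissonKernel_mul_torusChar hr0.le hr1]
          ring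
  rw [h0] at h1
  refine (mul_eq_zero.1 h1.symm).resolve_left (Finset.prod_ne_zero_iff.2 fun l _ ↦ ?_)
  have hr := hr0.ne'
  simp [hr, Real.pi_pos.ne']

theorem torusChar_add {n : ℕ} (k m : Fin n → ℤ) (ζ : Torus n) :
    torusChar (k + m) ζ = torusChar k ζ * torusChar m ζ := by
  simp only [torusChar, ← Finset.prod_mul_distrib, Pi.add_apply]
  exact Finset.prod_congr rfl fun l _ ↦ zpow_add₀ (Circle.coe_ne_zero _) _ _

theorem norm_torusChar {n : ℕ} (k : Fin n → ℤ) (ζ : Torus n) : ‖torusChar k ζ‖ = 1 := by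
  simp [torusChar, Circle.norm_coe]

/-! ### The closed algebra and its annihilating measures -/

/-- A closed subalgebra is complete, so the Neumann series for the inverse of `1 - x` converges
inside it. -/
theorem Subalgebra.exists_mul_one_sub_eq_one {R : Type*} [NormedRing R] [NormedAlgebra ℂ R]
    [CompleteSpace R] (S : Subalgebra ℂ R) (hS : IsClosed (S : Set R)) {x : R} (hx : x ∈ S)
    (h : ‖x‖ < 1) : ∃ y ∈ S, y * (1 - x) = 1 := by
  have : CompleteSpace S := hS.completeSpace_coe
  let u : Sˣ := Units.oneSub (⟨x, hx⟩ : S) h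
  refine ⟨(↑u⁻¹ : S), (↑u⁻¹ : S).2, ?_⟩
  exact congrArg (Subtype.val : S → R) u.inv_mul

theorem Subalgebra.exp_mem {R : Type*} [NormedRing R] [NormedAlgebra ℂ R]
    [CompleteSpace R] (S : Subalgebra ℂ R) (hS : IsClosed (S : Set R)) {x : R} (hx : x ∈ S) :
    NormedSpace.exp x ∈ S := by
  have : CompleteSpace S := hS.completeSpace_coe
  let _ : NormedAlgebra ℚ S := NormedAlgebra.restrictScalars ℚ ℂ S
  let _ : NormedAlgebra ℚ R := NormedAlgebra.restrictScalars ℚ ℂ R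
  have := NormedSpace.map_exp S.val continuous_subtype_val (⟨x, hx⟩ : S)
  rw [show x = S.val (⟨x, hx⟩ : S) from rfl, ← this]
  exact (NormedSpace.exp (⟨x, hx⟩ : S)).2

theorem ContinuousMap.exp_apply {X : Type*} [TopologicalSpace X] [CompactSpace X] (g : C(X, ℂ))
    (x : X) : NormedSpace.exp g x = Complex.exp (g x) := by
  let _ : NormedAlgebra ℚ C(X, ℂ) := NormedAlgebra.restrictScalars ℚ ℂ C(X, ℂ)
  rw [Complex.exp_eq_exp_ℂ]
  exact NormedSpace.map_exp (ContinuousMap.evalAlgHom ℂ ℂ x) (continuous_eval_const x) g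

/-- The coordinate function `ζ ↦ ζ_l ^ e_l` on the torus. -/
noncomputable def torusCoord {n : ℕ} (e : Fin n → ℤ) (l : Fin n) : C(Torus n, ℂ) :=
  ⟨fun ζ ↦ (ζ l : ℂ) ^ e l,
    Continuous.zpow₀ (by fun_prop) _ fun _ ↦ Or.inl (Circle.coe_ne_zero _)⟩

/-- The uniformly closed algebra generated by the functions `ζ_l ^ e_l`. -/
noncomputable def torusAlgebra {n : ℕ} (e : Fin n → ℤ) : Subalgebra ℂ C(Torus n, ℂ) :=
  (Algebra.adjoin ℂ (Set.range (torusCoord e))).topologicalClosure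

theorem isClosed_torusAlgebra {n : ℕ} (e : Fin n → ℤ) :
    IsClosed (torusAlgebra e : Set C(Torus n, ℂ)) :=
  Subalgebra.isClosed_topologicalClosure _

theorem torusCoord_mem {n : ℕ} (e : Fin n → ℤ) (l : Fin n) : torusCoord e l ∈ torusAlgebra e :=
  Subalgebra.le_topologicalClosure _ (Algebra.subset_adjoin ⟨l, rfl⟩)

theorem continuous_integral_mul_of_norm_le_one {X : Type*} [TopologicalSpace X] [CompactSpace X]
    [MeasurableSpace X] [OpensMeasurableSpace X] {ν : Measure X} [IsFiniteMeasure ν] {w : X → ℂ}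
    (hw : Measurable w) (hw1 : ∀ x, ‖w x‖ ≤ 1) :
    Continuous fun g : C(X, ℂ) ↦ ∫ x, w x * g x ∂ν := by
  have hint : ∀ g : C(X, ℂ), Integrable (fun x ↦ w x * g x) ν := fun g ↦
    (g.continuous.integrable_of_hasCompactSupport (HasCompactSupport.of_compactSpace _)).bdd_mul
      hw.aestronglyMeasurable (Filter.Eventually.of_forall hw1)
  refine (LipschitzWith.of_dist_le_mul (K := (ν.real Set.univ).toNNReal) fun g h ↦ ?_).continuous
  rw [dist_eq_norm, ← integral_sub (hint g) (hint h), Real.coe_toNNReal _ measureReal_nonneg,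
    dist_eq_norm, mul_comm]
  refine norm_integral_le_of_norm_le_const (Filter.Eventually.of_forall fun x ↦ ?_)
  rw [← mul_sub, norm_mul]
  calc ‖w x‖ * ‖g x - h x‖ ≤ 1 * ‖g - h‖ :=
        mul_le_mul (hw1 x) ((g - h).norm_coe_le_norm x) (norm_nonneg _) zero_le_one
    _ = _ := one_mul _

/-- The functional is continuous and polynomials in the generators are dense, so testing on
monomials suffices. -/
theorem integral_mul_eq_zero_of_mem_torusAlgebra {n : ℕ} {ν : Measure (Torus n)}
    [IsFiniteMeasure ν] {w : Torus n → ℂ} (hw : Measurable w) (hw1 : ∀ x, ‖w x‖ ≤ 1)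
    {e : Fin n → ℤ} (h : ∀ d : Fin n → ℕ, ∫ ζ, w ζ * torusChar (fun l ↦ e l * d l) ζ ∂ν = 0)
    {g : C(Torus n, ℂ)} (hg : g ∈ torusAlgebra e) : ∫ ζ, w ζ * g ζ ∂ν = 0 := by
  have hcl : IsClosed {g : C(Torus n, ℂ) | ∫ ζ, w ζ * g ζ ∂ν = 0} :=
    isClosed_eq (continuous_integral_mul_of_norm_le_one hw hw1) continuous_const
  refine closure_minimal (fun g hg ↦ ?_) hcl hg
  rw [SetLike.mem_coe, Algebra.adjoin_range_eq_range_aeval] at hg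
  obtain ⟨q, rfl⟩ := hg
  have hq : ∀ ζ, (MvPolynomial.aeval (torusCoord e) q : C(Torus n, ℂ)) ζ =
      ∑ d ∈ q.support, q.coeff d * torusChar (fun l ↦ e l * d l) ζ := by
    intro ζ
    rw [MvPolynomial.aeval_def, MvPolynomial.eval₂_eq', ContinuousMap.sum_apply]
    refine Finset.sum_congr rfl fun d _ ↦ ?_
    simp [torusCoord, torusChar, ContinuousMap.prod_apply, zpow_mul]
  change ∫ ζ, w ζ * (MvPolynomial.aeval (torusCoord e) q : C(Torus n, ℂ)) ζ ∂ν = 0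
  simp_rw [hq, Finset.mul_sum]
  rw [integral_finsetSum]
  · refine Finset.sum_eq_zero fun d _ ↦ ?_
    simp_rw [mul_left_comm (w _)]
    rw [integral_const_mul, h, mul_zero]
  · intro d _
    refine Integrable.bdd_mul (c := 1) ?_ hw.aestronglyMeasurable (Filter.Eventually.of_forall hw1)
    have := continuous_torusChar (fun l ↦ e l * d l)
    exact Continuous.integrable_of_hasCompactSupport (by fun_prop)
      (HasCompactSupport.of_compactSpace _)

/-! ### Kernels concentrated near a point or a compact set -/

theorem two_mul_re_one_sub_of_norm_eq_one {u : ℂ} (hu : ‖u‖ = 1) :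
    2 * (1 - u).re = ‖1 - u‖ ^ 2 := by
  have h : ‖u‖ ^ 2 = 1 := by rw [hu, one_pow]
  rw [Complex.sq_norm, Complex.normSq_apply] at *
  simp only [Complex.sub_re, Complex.sub_im, Complex.one_re, Complex.one_im]
  linear_combination -h

theorem norm_one_sub_circle_zpow {e : ℤ} (he : e = 1 ∨ e = -1) (p z : Circle) :
    ‖1 - ((p : ℂ) ^ e)⁻¹ * (z : ℂ) ^ e‖ = dist z p := by
  have h : dist z p = ‖(z : ℂ) - p‖ := by rw [← dist_eq_norm]; rfl
  have hp := Circle.coe_ne_zero p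
  have hz := Circle.coe_ne_zero z
  rcases he with rfl | rfl
  · rw [h, norm_sub_rev, zpow_one, zpow_one,
      show (z : ℂ) - p = p * ((p : ℂ)⁻¹ * z - 1) by field_simp, norm_mul, Circle.norm_coe, one_mul]
  · rw [h, zpow_neg_one, zpow_neg_one, inv_inv,
      show (z : ℂ) - p = z * (1 - p * (z : ℂ)⁻¹) by field_simp, norm_mul, Circle.norm_coe, one_mul]

/-- Here `h = r / w` with `w = r + ∑ a l` and `Re w ≥ r`. If all `‖a l‖ ≤ r`, then `‖w‖ ≤ (n + 1)
r`, which bounds `Re h = r Re w / ‖w‖²` below. The decay comes from `‖a l‖² = 2 Re (a l) ≤ 2 ‖w‖`.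
-/
theorem estimates_of_mul_eq {n : ℕ} {a : Fin n → ℂ} (ha : ∀ l, 2 * (a l).re = ‖a l‖ ^ 2) {r : ℝ}
    (hr : 0 < r) {h : ℂ} (hh : h * (r + ∑ l, a l) = r) :
    0 ≤ h.re ∧ ((∀ l, ‖a l‖ ≤ r) → 1 / ((n : ℝ) + 1) ^ 2 ≤ h.re) ∧ ∀ l, ‖h‖ * ‖a l‖ ^ 2 ≤ 2 * r := by
  set w : ℂ := r + ∑ l, a l with hw
  have hre : ∀ l, 0 ≤ (a l).re := fun l ↦ by nlinarith [ha l, sq_nonneg ‖a l‖]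
  have hwre : w.re = r + ∑ l, (a l).re := by simp [hw]
  have hsum : ∀ l, (a l).re ≤ ∑ l, (a l).re := fun l ↦
    Finset.single_le_sum (f := fun l ↦ (a l).re) (fun l _ ↦ hre l) (Finset.mem_univ l)
  have hrw : r ≤ w.re := by
    rw [hwre]; linarith [Finset.sum_nonneg fun l (_ : l ∈ Finset.univ) ↦ hre l]
  have hw0 : w ≠ 0 := by
    intro h0; rw [h0] at hrw; simp at hrw; linarith
  have hwn : 0 < ‖w‖ := norm_pos_iff.2 hw0
  have hhe : h = r / w := by rw [eq_div_iff hw0, hh]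
  have hhre : h.re = r * w.re / ‖w‖ ^ 2 := by
    rw [hhe, Complex.div_re, Complex.sq_norm]; simp
  refine ⟨?_, fun hal ↦ ?_, fun l ↦ ?_⟩
  · rw [hhre]
    have := hr.le.trans hrw
    positivity
  · have hwle : ‖w‖ ≤ r * (n + 1) := by
      calc ‖w‖ ≤ ‖(r : ℂ)‖ + ‖∑ l, a l‖ := norm_add_le _ _
        _ ≤ r + ∑ l : Fin n, r := by
          gcongr
          · simp [abs_of_pos hr]
          · exact norm_sum_le_of_le _ fun l _ ↦ hal l
        _ = r * (n + 1) := by simp; ring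
    rw [hhre, div_le_div_iff₀ (by positivity) (by positivity), one_mul]
    calc ‖w‖ ^ 2 ≤ (r * (n + 1)) ^ 2 := by gcongr
      _ = r * r * (n + 1) ^ 2 := by ring
      _ ≤ r * w.re * (n + 1) ^ 2 := by gcongr
  · have h1 : ‖h‖ * ‖w‖ = r := by rw [← norm_mul, hh]; simp [abs_of_pos hr]
    have h2 : ‖a l‖ ^ 2 ≤ 2 * ‖w‖ := by
      have := Complex.re_le_norm w
      linarith [ha l, hsum l]
    calc ‖h‖ * ‖a l‖ ^ 2 ≤ ‖h‖ * (2 * ‖w‖) := by gcongr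
      _ = 2 * r := by rw [← h1]; ring

/-- The denominator is `(r + n)(1 - x)` with `‖x‖ ≤ n / (r + n) < 1`, hence invertible in the
algebra. -/
theorem exists_mem_torusAlgebra_mul_eq {n : ℕ} (e : Fin n → ℤ) (p : Torus n) {r : ℝ} (hr : 0 < r) :
    ∃ h ∈ torusAlgebra e, ∀ ζ : Torus n,
      h ζ * (r + ∑ l, (1 - ((p l : ℂ) ^ e l)⁻¹ * (ζ l : ℂ) ^ e l)) = r := by
  have hrn : (0 : ℝ) < r + n := by positivity
  have hrn' : (r : ℂ) + n ≠ 0 := by exact_mod_cast hrn.ne'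
  let x : C(Torus n, ℂ) := ∑ l, (((r : ℂ) + n)⁻¹ * ((p l : ℂ) ^ e l)⁻¹) • torusCoord e l
  have hx : x ∈ torusAlgebra e :=
    Subalgebra.sum_mem _ fun l _ ↦ Subalgebra.smul_mem _ (torusCoord_mem e l) _
  have hxv : ∀ ζ, x ζ = ((r : ℂ) + n)⁻¹ * ∑ l, ((p l : ℂ) ^ e l)⁻¹ * (ζ l : ℂ) ^ e l := by
    intro ζ
    simp [x, torusCoord, ContinuousMap.sum_apply, Finset.mul_sum, mul_assoc]
  have hx1 : ‖x‖ < 1 := by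
    rw [ContinuousMap.norm_lt_iff _ one_pos]
    intro ζ
    rw [hxv, norm_mul, norm_inv, inv_mul_lt_iff₀ (by simpa using hrn')]
    have h1 : ‖∑ l, ((p l : ℂ) ^ e l)⁻¹ * (ζ l : ℂ) ^ e l‖ ≤ ∑ l : Fin n, (1 : ℝ) :=
      norm_sum_le_of_le _ fun l _ ↦ by simp [Circle.norm_coe]
    have h2 : ‖(r : ℂ) + n‖ = r + n := by
      rw [show (r : ℂ) + n = ((r + n : ℝ) : ℂ) by push_cast; rfl, Complex.norm_real,
        Real.norm_of_nonneg hrn.le]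
    simp at h1
    linarith
  obtain ⟨y, hy, hy1⟩ := (torusAlgebra e).exists_mul_one_sub_eq_one (isClosed_torusAlgebra e) hx hx1
  refine ⟨((r : ℂ) / (r + n)) • y, Subalgebra.smul_mem _ hy _, fun ζ ↦ ?_⟩
  have hyζ := congrArg (fun g : C(Torus n, ℂ) ↦ g ζ) hy1
  simp only [ContinuousMap.mul_apply, ContinuousMap.sub_apply, ContinuousMap.one_apply, hxv] at hyζ
  rw [Finset.sum_sub_distrib]
  simp only [ContinuousMap.smul_apply, smul_eq_mul, Finset.sum_const, Finset.card_univ,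
    Fintype.card_fin, nsmul_eq_mul, mul_one]
  calc _ = r * (y ζ * (1 - ((r : ℂ) + n)⁻¹ * ∑ l, ((p l : ℂ) ^ e l)⁻¹ * (ζ l : ℂ) ^ e l)) := by
        field_simp
        ring
    _ = r := by rw [hyζ, mul_one]

theorem exists_mem_torusAlgebra_kernel {n : ℕ} {e : Fin n → ℤ} (he : ∀ l, e l = 1 ∨ e l = -1)
    (p : Torus n) {r : ℝ} (hr : 0 < r) :
    ∃ h ∈ torusAlgebra e, ∀ ζ, 0 ≤ (h ζ).re ∧
      (dist ζ p ≤ r → 1 / ((n : ℝ) + 1) ^ 2 ≤ (h ζ).re) ∧ ‖h ζ‖ * dist ζ p ^ 2 ≤ 2 * r := by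
  obtain ⟨h, hA, hh⟩ := exists_mem_torusAlgebra_mul_eq e p hr
  refine ⟨h, hA, fun ζ ↦ ?_⟩
  have hhζ := hh ζ
  have hd : ∀ l, ‖1 - ((p l : ℂ) ^ e l)⁻¹ * (ζ l : ℂ) ^ e l‖ = dist (ζ l) (p l) :=
    fun l ↦ norm_one_sub_circle_zpow (he l) _ _
  have hu : ∀ l, ‖((p l : ℂ) ^ e l)⁻¹ * (ζ l : ℂ) ^ e l‖ = 1 := fun l ↦ by
    simp [Circle.norm_coe]
  obtain ⟨h1, h2, h3⟩ := estimates_of_mul_eq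
    (fun l ↦ two_mul_re_one_sub_of_norm_eq_one (hu l)) hr hhζ
  simp only [hd] at h2 h3
  refine ⟨h1, fun hζ ↦ h2 fun l ↦ (dist_le_pi_dist _ _ l).trans hζ, ?_⟩
  rcases (norm_nonneg (h ζ)).eq_or_lt with h0 | h0
  · rw [← h0, zero_mul]; positivity
  · have h4 : dist ζ p ≤ Real.sqrt (2 * r / ‖h ζ‖) := by
      refine (dist_pi_le_iff (Real.sqrt_nonneg _)).2 fun l ↦ Real.le_sqrt_of_sq_le ?_
      rw [le_div_iff₀' h0]
      exact h3 l
    have h5 := pow_le_pow_left₀ dist_nonneg h4 2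
    rwa [Real.sq_sqrt (by positivity), le_div_iff₀' h0] at h5

/-- Each kernel is bounded off its centre linearly in its radius, so the sum is controlled by `∑ r`;
this is where dimension one enters. -/
theorem exists_mem_torusAlgebra_re_ge {n : ℕ} {e : Fin n → ℤ} (he : ∀ l, e l = 1 ∨ e l = -1)
    {K : Set (Torus n)} (hK : IsCompact K) (h0 : HasLinearMeasureZero K) {ε : ℝ} (hε : 0 < ε) :
    ∃ H ∈ torusAlgebra e, (∀ ζ, 0 ≤ (H ζ).re) ∧ (∀ ζ ∈ K, 1 / ((n : ℝ) + 1) ^ 2 ≤ (H ζ).re) ∧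
      ∀ ζ, ‖H ζ‖ * Metric.infDist ζ K ^ 2 ≤ 2 * ε := by
  obtain ⟨t, p, r, hp, hr, hcov, hsum⟩ := h0.exists_finite_cover hK hε
  choose h hA hh using fun q ↦ exists_mem_torusAlgebra_kernel he (p q) (hr q)
  refine ⟨∑ q, h q, Subalgebra.sum_mem _ fun q _ ↦ hA q, fun ζ ↦ ?_, fun ζ hζ ↦ ?_, fun ζ ↦ ?_⟩
  · rw [ContinuousMap.sum_apply, Complex.re_sum]
    exact Finset.sum_nonneg fun q _ ↦ (hh q ζ).1
  · rw [ContinuousMap.sum_apply, Complex.re_sum]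
    obtain ⟨q, hq⟩ := hcov ζ hζ
    exact ((hh q ζ).2.1 hq).trans
      (Finset.single_le_sum (f := fun q ↦ (h q ζ).re) (fun q _ ↦ (hh q ζ).1) (Finset.mem_univ q))
  · rw [ContinuousMap.sum_apply]
    calc ‖∑ q, h q ζ‖ * Metric.infDist ζ K ^ 2
        ≤ (∑ q, ‖h q ζ‖) * Metric.infDist ζ K ^ 2 := by
          gcongr
          exact norm_sum_le _ _
      _ = ∑ q, ‖h q ζ‖ * Metric.infDist ζ K ^ 2 := Finset.sum_mul _ _ _
      _ ≤ ∑ q, 2 * r q := by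
          refine Finset.sum_le_sum fun q _ ↦ le_trans ?_ (hh q ζ).2.2
          have := Metric.infDist_le_dist_of_mem (x := ζ) (hp q)
          have := Metric.infDist_nonneg (x := ζ) (s := K)
          gcongr
      _ = 2 * ∑ q, r q := by rw [Finset.mul_sum]
      _ ≤ 2 * ε := by gcongr

/-! ### Annihilating measures and sets of linear measure zero -/

/-- If `w dν` annihilates the algebra, it does not charge compact sets of linear measure zero. -/
theorem setIntegral_eq_zero_of_hasLinearMeasureZero {n : ℕ} {e : Fin n → ℤ}
    (he : ∀ l, e l = 1 ∨ e l = -1) {ν : Measure (Torus n)} [IsFiniteMeasure ν] {w : Torus n → ℂ}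
    (hw : Measurable w) (hw1 : ∀ x, ‖w x‖ ≤ 1)
    (h : ∀ g ∈ torusAlgebra e, ∫ ζ, w ζ * g ζ ∂ν = 0)
    {K : Set (Torus n)} (hK : IsCompact K) (h0 : HasLinearMeasureZero K) :
    ∫ ζ in K, w ζ ∂ν = 0 := by
  rcases K.eq_empty_or_nonempty with rfl | hne
  · simp
  have hwi : Integrable w ν := Integrable.of_bound hw.aestronglyMeasurable 1
    (Filter.Eventually.of_forall hw1)
  -- The choice `ε = 1 / (m + 1)²` makes `m H_m` tend to `0` off `K`, while `m Re H_m` tends to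
  -- infinity on `K`.
  choose H hHA hH0 hHK hHd using fun m : ℕ ↦
    exists_mem_torusAlgebra_re_ge he hK h0 (ε := 1 / ((m : ℝ) + 1) ^ 2) (by positivity)
  let G : ℕ → C(Torus n, ℂ) := fun m ↦ NormedSpace.exp ((-(m : ℂ)) • H m)
  have hGA : ∀ m, G m ∈ torusAlgebra e := fun m ↦
    (torusAlgebra e).exp_mem (isClosed_torusAlgebra e) (Subalgebra.smul_mem _ (hHA m) _)
  have hGv : ∀ m ζ, G m ζ = Complex.exp (-(m : ℂ) * H m ζ) := fun m ζ ↦ by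
    rw [ContinuousMap.exp_apply]; rfl
  have hGn : ∀ m ζ, ‖G m ζ‖ = Real.exp (-(m * (H m ζ).re)) := fun m ζ ↦ by
    rw [hGv, Complex.norm_exp]; simp
  have hlim : ∀ ζ, Filter.Tendsto (fun m ↦ w ζ * G m ζ) Filter.atTop
      (nhds (Kᶜ.indicator w ζ)) := by
    intro ζ
    by_cases hζ : ζ ∈ K
    · rw [Set.indicator_of_notMem (by simpa using hζ), ← mul_zero (w ζ)]
      refine Filter.Tendsto.const_mul _ (squeeze_zero_norm
        (a := fun m : ℕ ↦ Real.exp (-(m * (1 / ((n : ℝ) + 1) ^ 2)))) (fun m ↦ ?_) ?_)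
      · rw [hGn]
        have := hHK m ζ hζ
        gcongr
      · refine Real.tendsto_exp_neg_atTop_nhds_zero.comp ?_
        exact tendsto_natCast_atTop_atTop.atTop_mul_const (by positivity)
    · rw [Set.indicator_of_mem (by simpa using hζ)]
      have hd : 0 < Metric.infDist ζ K :=
        (hK.isClosed.notMem_iff_infDist_pos hne).1 hζ
      have h1 : Filter.Tendsto (fun m : ℕ ↦ -(m : ℂ) * H m ζ) Filter.atTop (nhds 0) := by
        refine squeeze_zero_norm
          (a := fun m : ℕ ↦ 2 / Metric.infDist ζ K ^ 2 * (1 / ((m : ℝ) + 1))) (fun m ↦ ?_) ?_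
        · have h2 : ‖H m ζ‖ ≤ 2 * (1 / ((m : ℝ) + 1) ^ 2) / Metric.infDist ζ K ^ 2 := by
            rw [le_div_iff₀ (by positivity)]
            exact hHd m ζ
          rw [norm_mul, norm_neg, Complex.norm_natCast]
          calc (m : ℝ) * ‖H m ζ‖
              ≤ (m + 1) * (2 * (1 / ((m : ℝ) + 1) ^ 2) / Metric.infDist ζ K ^ 2) := by
                gcongr
                linarith
            _ = _ := by field_simp
        · simpa only [mul_zero] using (tendsto_one_div_add_atTop_nhds_zero_nat (𝕜 := ℝ)).const_mul
            (2 / Metric.infDist ζ K ^ 2)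
      have h2 := ((Complex.continuous_exp.tendsto 0).comp h1).const_mul (w ζ)
      rw [Complex.exp_zero, mul_one] at h2
      simpa only [hGv, Function.comp_apply] using h2
  have hT := tendsto_integral_of_dominated_convergence (μ := ν) (fun _ ↦ (1 : ℝ))
    (F := fun m ζ ↦ w ζ * G m ζ) (f := Kᶜ.indicator w)
    (fun m ↦ (hw.mul (G m).continuous.measurable).aestronglyMeasurable)
    (integrable_const _) (fun m ↦ Filter.Eventually.of_forall fun ζ ↦ ?_)
    (Filter.Eventually.of_forall hlim)
  -- The limit gives `∫_{Kᶜ} w = 0`; the constant `1` in the algebra gives `∫ w = 0`, and the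
  -- difference is the integral over `K`.
  · simp_rw [fun m ↦ h (G m) (hGA m)] at hT
    have h1 := tendsto_nhds_unique hT tendsto_const_nhds
    rw [integral_indicator hK.measurableSet.compl] at h1
    have h2 := integral_add_compl hK.measurableSet hwi
    have h3 := h 1 (one_mem _)
    simp only [ContinuousMap.one_apply, mul_one] at h3
    rw [h1, h3, add_zero] at h2
    exact h2
  · rw [norm_mul, hGn]
    refine mul_le_one₀ (hw1 ζ) (Real.exp_nonneg _) (Real.exp_le_one_iff.2 ?_)
    have := hH0 m ζ
    have : 0 ≤ (m : ℝ) * (H m ζ).re := by positivity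
    linarith

/-! ### Conclusion for `RP` -/

theorem isNullSetFor_RP {n : ℕ} (hn : 2 ≤ n) {K : Set (Torus n)} (hK : IsCompact K)
    (h0 : HasLinearMeasureZero K) : IsNullSetFor K (RP n) := by
  rintro μ ⟨f, hf, hfμ⟩
  obtain ⟨s, hs, hs1, hsμ⟩ := exists_sign_integral_eq μ
  have : IsFiniteMeasure μ.variation := by
    rw [← μ.totalVariation_eq_variation]; infer_instance
  let i : Fin n := ⟨0, by omega⟩
  let j : Fin n := ⟨1, by omega⟩
  have hij : i ≠ j := by simp [i, j]
  let e : Fin n → ℤ := fun l ↦ if l = j then -1 else 1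
  have he : ∀ l, e l = 1 ∨ e l = -1 := fun l ↦ by
    by_cases h : l = j <;> simp [e, h]
  -- For `d ≥ 0`, `k₀ + e d` has entry `1 + d i` at `i` and `-1 - d j` at `j`, so every frequency
  -- tested has mixed sign.
  let k₀ : Fin n → ℤ := Pi.single i 1 - Pi.single j 1
  have hu : ∀ z ∈ polydisc n, ∫ ζ, s ζ * polyPoissonKernel z ζ ∂μ.variation = (f z).re := by
    intro z hz
    rw [← hfμ z hz, poissonIntegral, hsμ]
    have hc : Continuous fun ζ : Torus n ↦ polyPoissonKernel z ζ := by
      unfold polyPoissonKernel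
      refine continuous_finsetProd _ fun l _ ↦ Continuous.div (by fun_prop) (by fun_prop) fun ζ ↦ ?_
      refine pow_ne_zero _ (norm_ne_zero_iff.2 fun h ↦ ?_)
      have := hz l
      rw [← sub_eq_zero.1 h, Circle.norm_coe] at this
      exact lt_irrefl _ this
    exact hc.integrable_of_hasCompactSupport (HasCompactSupport.of_compactSpace _)
  let w : Torus n → ℂ := fun ζ ↦ (s ζ : ℂ) * torusChar k₀ ζ
  have hw : Measurable w :=
    (Complex.measurable_ofReal.comp hs).mul (continuous_torusChar k₀).measurable
  have hw1 : ∀ ζ, ‖w ζ‖ = 1 := fun ζ ↦ by simp [w, norm_torusChar, hs1]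
  have hann : ∀ g ∈ torusAlgebra e, ∫ ζ, w ζ * g ζ ∂μ.variation = 0 := fun g hg ↦ by
    refine integral_mul_eq_zero_of_mem_torusAlgebra hw (fun ζ ↦ (hw1 ζ).le) (fun d ↦ ?_) hg
    simp only [w, mul_assoc, ← torusChar_add]
    refine integral_sign_mul_torusChar_eq_zero hs hs1 hf hu _ (i := i) (j := j) ?_ ?_
    · simp [k₀, e, hij]; omega
    · simp [k₀, e, hij.symm]; omega
  -- Closed subsets of `K` inherit compactness and linear measure zero, and integrals over closed
  -- sets determine `w` a.e.
  have hae : w =ᵐ[μ.variation.restrict K] 0 := by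
    refine ae_eq_zero_of_forall_setIntegral_isClosed_eq_zero ?_ fun F hF ↦ ?_
    · exact Integrable.of_bound hw.aestronglyMeasurable 1
        (Filter.Eventually.of_forall fun ζ ↦ (hw1 ζ).le)
    · rw [Measure.restrict_restrict hF.measurableSet]
      exact setIntegral_eq_zero_of_hasLinearMeasureZero he hw (fun ζ ↦ (hw1 ζ).le) hann
        (hK.inter_left hF) (h0.mono Set.inter_subset_right)
  rw [← Measure.restrict_eq_zero, ← ae_eq_bot, ← Filter.eventually_false_iff_eq_bot]
  filter_upwards [hae] with ζ hζ
  have := hw1 ζ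
  simp [hζ] at this

theorem mainTheorem3 (n : ℕ) (hn : 2 ≤ n) :
    (∀ K : Set (Torus n), IsCompact K → HasLinearMeasureZero K → IsNullSetFor K (RP n)) ∧
    (∀ μ ∈ RP n, μ ≠ 0 →
      ¬ HasLinearMeasureZero (signedSupport μ) ∧ 1 ≤ dimH (signedSupport μ)) := by
  refine ⟨fun K hK h0 ↦ isNullSetFor_RP hn hK h0, fun μ hμ hne ↦ ?_⟩
  have key : ¬ HasLinearMeasureZero (signedSupport μ) := fun h0 ↦ by
    have hK : IsCompact (signedSupport μ) := Measure.isClosed_support.isCompact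
    have h1 := isNullSetFor_RP hn hK h0 μ hμ
    have h2 := variation_compl_signedSupport μ
    refine hne (VectorMeasure.variation_eq_zero.1 (Measure.measure_univ_eq_zero.1 ?_))
    rw [← Set.union_compl_self (signedSupport μ)]
    exact measure_union_null h1 h2
  exact ⟨key, not_lt.1 fun h ↦ key (hasLinearMeasureZero_of_dimH_lt_one h)⟩
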